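/- All graphs are finite, simple and undirected. Let $G$ be a connected graph and let $d(x,y)$ denote the distance between vertices $x$ and $y$. A set $W\subseteq V(G)$ is a resolving set of $G$ if for any two distinct vertices $u,v$ there is $w\in W$ with $d(u,w)\neq d(v,w)$. A basis is a resolving set of minimum cardinality, and this cardinality is the metric dimension $\dim_M(G)$. A $2$-tree is a graph formed by starting with three pairwise adjacent vertices and then repeatedly adding a new vertex that is adjacent to exactly two of the existing vertices, these two being adjacent to each other. A $2$-path is a graph isomorphic to the graph with vertices $v_1,\dots,v_n$ ($n\ge 3$) in which distinct $v_i,v_j$ are adjacent if and only if $|i-j|\le 2$. A cane is a graph isomorphic to one obtained from such a $2$-path $v_1,\dots,v_n$ ($n\ge 3$) by adding one new vertex $x$ whose neighbours are exactly $v_1$ and $v_3$. **Proposition.** Let $G$ be a $2$-tree with $\dim_M(G)=2$ that has a basis $\{a,b\}$ with $a$ and $b$ adjacent. Then $G$ is a $2$-path or a cane. -/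

import Mathlib

/-- A set `W` of vertices resolves `G` when distinct vertices of `G` have distinct vectors of
distances to `W`. -/
def IsResolving {V : Type*} (G : SimpleGraph V) (W : Finset V) : Prop :=
  ∀ u v : V, (∀ w ∈ W, G.dist u w = G.dist v w) → u = v

/-- A basis is a resolving set of minimum cardinality. -/
def IsMetricBasis {V : Type*} (G : SimpleGraph V) (W : Finset V) : Prop :=
  IsResolving G W ∧ ∀ W' : Finset V, IsResolving G W' → W.card ≤ W'.card

/-- The metric dimension (of a finite connected graph): the minimum cardinality of a resolving
set. -/
noncomputable def metricDim {V : Type*} (G : SimpleGraph V) : ℕ :=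
  sInf {d : ℕ | ∃ W : Finset V, IsResolving G W ∧ W.card = d}

/-- A `k`-tree: the vertices can be listed as `v 0, v 1, …` so that the first `k + 1` of them are
pairwise adjacent, and every later vertex has, among the vertices listed before it, exactly `k`
neighbours, which form a clique. -/
def IsKTree {V : Type*} (k : ℕ) (G : SimpleGraph V) : Prop :=
  ∃ (n : ℕ) (v : Fin n ≃ V), k + 1 ≤ n ∧
    (∀ i j : Fin n, i.val ≤ k → j.val ≤ k → i ≠ j → G.Adj (v i) (v j)) ∧
    ∀ i : Fin n, k < i.val →
      ∃ s : Finset V, G.IsNClique k s ∧ ∀ j : Fin n, v j ∈ s ↔ j < i ∧ G.Adj (v j) (v i)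

/-- The graph on `0, …, n - 1` in which distinct `i`, `j` are adjacent iff `|i - j| ≤ k`. -/
def kPathGraph (k n : ℕ) : SimpleGraph (Fin n) where
  Adj i j := i ≠ j ∧ i.val ≤ j.val + k ∧ j.val ≤ i.val + k
  symm := ⟨fun _ _ h => ⟨h.1.symm, h.2.2, h.2.1⟩⟩
  loopless := ⟨fun _ h => h.1 rfl⟩

/-- A `k`-path: a graph isomorphic to some `kPathGraph k n` that is a `k`-tree,
i.e. with `n ≥ k + 1`. -/
def IsKPath {V : Type*} (k : ℕ) (G : SimpleGraph V) : Prop :=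
  ∃ n : ℕ, k + 1 ≤ n ∧ Nonempty (G ≃g kPathGraph k n)

/-- Adjacency in the cane on `m + 1` vertices: the `2`-path on `0, …, m - 1` and one extra vertex
`none`, whose neighbours are exactly `0` and `2`, i.e. the ends of the edge that joins the first
and the third vertex of the `2`-path. -/
def caneAdj (m : ℕ) : Option (Fin m) → Option (Fin m) → Prop
  | some i, some j => (kPathGraph 2 m).Adj i j
  | some i, none => i.val = 0 ∨ i.val = 2
  | none, some j => j.val = 0 ∨ j.val = 2
  | none, none => False

/-- The cane built on the `2`-path with `m` vertices. -/
def caneGraph (m : ℕ) : SimpleGraph (Option (Fin m)) where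
  Adj := caneAdj m
  symm := ⟨fun p q h => by
    cases p <;> cases q <;> first | exact h | exact (kPathGraph 2 m).symm.symm _ _ h⟩
  loopless := ⟨fun p h => by
    cases p
    · exact h
    · exact (kPathGraph 2 m).loopless.irrefl _ h⟩

/-- A cane: a `2`-path (on `m ≥ 3` vertices) with one further vertex attached as above. -/
def IsCane {V : Type*} (G : SimpleGraph V) : Prop :=
  ∃ m : ℕ, 3 ≤ m ∧ Nonempty (G ≃g caneGraph m)

/-! A 2-tree can be grown from any of its edges (`TwoTreeOn.reroot`), so grow `G` from `ab`. Give
each vertex the position (f, g), its distances in `G` to `a` and `b`; distinct vertices have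
distinct positions. A vertex attached to `pq` gets the position (min(f p, f q) + 1, min(g p, g q) +
1) by `descent_of_insert`, so each attachment must land on a free position.

Along a strip b, a, v 2, v 3, … the positions are (1,0), (0,1), (1,1), (1,2), (2,2), …. An edge of
the strip yields the next position, which is free only at the far end, or a position already taken;
the sole exception is the edge v 0 v 2, which yields (2,1). That gives a cane, or, on a strip of
three vertices, a longer strip with `a` and `b` exchanged. A second vertex can be attached at the
extra vertex of a cane only if the strip has four vertices, and then the roles of `a` and `b` are
exchanged again. -/

/-- `G.TwoTreeOn a b S`: the vertices in `S` span a `2`-tree built up from the edge `ab`. -/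
inductive TwoTreeOn {V : Type*} (G : SimpleGraph V) (a b : V) : Set V → Prop
  | edge : G.Adj a b → TwoTreeOn G a b {a, b}
  | attach {S : Set V} {x p q : V} : TwoTreeOn G a b S → x ∉ S → p ∈ S → q ∈ S → G.Adj p q →
      (∀ y ∈ S, G.Adj x y ↔ y = p ∨ y = q) → TwoTreeOn G a b (insert x S)

/-! ### Growing a 2-tree from any edge -/

namespace TwoTreeOn

variable {V : Type*} {G : SimpleGraph V} {a b : V} {S : Set V}

theorem left_mem (h : TwoTreeOn G a b S) : a ∈ S := by
  induction h with
  | edge _ => simp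
  | attach _ _ _ _ _ _ ih => exact Set.mem_insert_of_mem _ ih

theorem symm (h : TwoTreeOn G a b S) : TwoTreeOn G b a S := by
  induction h with
  | edge h => rw [Set.pair_comm]; exact edge h.symm
  | attach _ hx hp hq hpq hadj ih => exact attach ih hx hp hq hpq hadj

theorem right_mem (h : TwoTreeOn G a b S) : b ∈ S := h.symm.left_mem

theorem reachable (h : TwoTreeOn G a b S) : ∀ x ∈ S, G.Reachable x a := by
  induction h with
  | edge h =>
    rintro x (rfl | rfl)
    · rfl
    · exact h.symm.reachable
  | @attach S x p q _ _ hp _ _ hadj ih =>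
    rintro y (rfl | hy)
    · exact ((hadj p hp).2 (Or.inl rfl)).reachable.trans (ih p hp)
    · exact ih y hy

/-- A vertex attached to the root edge can replace an end of that edge. -/
theorem insert_root {x : V} (h : TwoTreeOn G a b S) (hx : x ∉ S)
    (hadj : ∀ y ∈ S, G.Adj x y ↔ y = a ∨ y = b) : TwoTreeOn G x a (insert x S) := by
  induction h with
  | edge h =>
    have hxa : G.Adj x a := (hadj a (by simp)).2 (Or.inl rfl)
    have hxb : G.Adj x b := (hadj b (by simp)).2 (Or.inr rfl)
    -- The triangle is symmetric: it is also `b` attached to the edge `xa`.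
    have e : (insert x {a, b} : Set V) = insert b {x, a} := by
      ext; simp only [Set.mem_insert_iff, Set.mem_singleton_iff]; tauto
    rw [e]
    refine attach (p := x) (q := a) (edge hxa) ?_ (by simp) (by simp) hxa ?_
    · rintro (h' | h')
      · exact hxb.ne h'.symm
      · exact h.ne h'.symm
    · rintro y (rfl | rfl)
      · simp [hxb.symm]
      · simp [h.symm]
  | @attach S y p q h hy hp hq hpq hyadj ih =>
    have hxS : x ∉ S := fun h' => hx (Set.mem_insert_of_mem _ h')
    rw [Set.insert_comm]
    -- As `x` sees only the ends of the root edge, later vertices can still be attached once `x` has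
    -- been moved to the front.
    have hxy : ¬ G.Adj x y := fun h' => by
      rcases (hadj y (Set.mem_insert _ _)).1 h' with rfl | rfl
      · exact hy h.left_mem
      · exact hy h.right_mem
    refine attach (p := p) (q := q) (ih hxS fun z hz => hadj z (Set.mem_insert_of_mem _ hz)) ?_
      (Set.mem_insert_of_mem _ hp) (Set.mem_insert_of_mem _ hq) hpq ?_
    · rintro (rfl | h')
      · exact hx (Set.mem_insert _ _)
      · exact hy h'
    · rintro z (rfl | hz)
      · refine iff_of_false (fun h' => hxy h'.symm) ?_
        rintro (rfl | rfl)
        · exact hxS hp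
        · exact hxS hq
      · exact hyadj z hz

/-- A `2`-tree can be built up from any of its edges. -/
theorem reroot (h : TwoTreeOn G a b S) :
    ∀ c ∈ S, ∀ d ∈ S, G.Adj c d → TwoTreeOn G c d S := by
  induction h with
  | edge h =>
    rintro c (rfl | rfl) d (rfl | rfl) hcd
    · exact absurd rfl hcd.ne
    · exact edge h
    · exact (edge h).symm
    · exact absurd rfl hcd.ne
  | @attach S x p q h hx hp hq hpq hadj ih =>
    have key : ∀ d ∈ S, G.Adj x d → TwoTreeOn G x d (insert x S) := by
      intro d hd hxd
      rcases (hadj d hd).1 hxd with rfl | rfl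
      · exact (ih _ hp _ hq hpq).insert_root hx hadj
      · exact (ih _ hq _ hp hpq.symm).insert_root hx
          fun y hy => (hadj y hy).trans or_comm
    rintro c (rfl | hc) d (rfl | hd) hcd
    · exact absurd rfl hcd.ne
    · exact key d hd hcd
    · exact (key c hc hcd.symm).symm
    · exact attach (ih c hc d hd hcd) hx hp hq hpq hadj

end TwoTreeOn

/-! ### From an ordering of the vertices to successive attachments -/

theorem IsKTree.exists_twoTreeOn {V : Type*} {G : SimpleGraph V} (hG : IsKTree 2 G) :
    3 ≤ Nat.card V ∧ ∃ a b, TwoTreeOn G a b Set.univ := by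
  classical
  obtain ⟨n, v, hn, hbase, hstep⟩ := hG
  refine ⟨by rw [← Nat.card_congr v, Nat.card_fin]; exact hn, v ⟨0, by omega⟩, v ⟨1, by omega⟩, ?_⟩
  have key : ∀ k, 2 ≤ k → k ≤ n →
      TwoTreeOn G (v ⟨0, by omega⟩) (v ⟨1, by omega⟩) {x | ∃ i : Fin n, i.val < k ∧ v i = x} := by
    intro k hk
    induction k, hk using Nat.le_induction with
    | base =>
      intro _
      convert TwoTreeOn.edge (hbase ⟨0, by omega⟩ ⟨1, by omega⟩ (by simp) (by simp) (by simp))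
        using 1
      ext x
      simp only [Set.mem_ofPred_eq, Set.mem_insert_iff, Set.mem_singleton_iff]
      constructor
      · rintro ⟨⟨i, hi⟩, hi2, rfl⟩
        have : i = 0 ∨ i = 1 := by simp at hi2; omega
        rcases this with rfl | rfl <;> simp
      · rintro (rfl | rfl)
        · exact ⟨_, by simp, rfl⟩
        · exact ⟨_, by simp, rfl⟩
    | succ k hk ih =>
      intro hkn
      have e : {x | ∃ i : Fin n, i.val < k + 1 ∧ v i = x} =
          insert (v ⟨k, by omega⟩) {x | ∃ i : Fin n, i.val < k ∧ v i = x} := by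
        ext x
        simp only [Set.mem_ofPred_eq, Set.mem_insert_iff]
        constructor
        · rintro ⟨i, hi, rfl⟩
          rcases Nat.lt_succ_iff_lt_or_eq.1 hi with h | h
          · exact Or.inr ⟨i, h, rfl⟩
          · exact Or.inl (congrArg v (Fin.ext h))
        · rintro (rfl | ⟨i, hi, rfl⟩)
          · exact ⟨_, by simp, rfl⟩
          · exact ⟨i, by omega, rfl⟩
      rw [e]
      have hx : v ⟨k, by omega⟩ ∉ {x | ∃ i : Fin n, i.val < k ∧ v i = x} := by
        rintro ⟨i, hi, h⟩
        rw [v.injective h] at hi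
        simp at hi
      -- The third vertex belongs to the initial clique, so its two neighbours come from `hbase`.
      rcases hk.eq_or_lt with rfl | hk
      · refine .attach (p := v ⟨0, by omega⟩) (q := v ⟨1, by omega⟩) (ih (by omega)) hx
          ⟨_, by simp, rfl⟩ ⟨_, by simp, rfl⟩ (hbase _ _ (by simp) (by simp) (by simp)) ?_
        rintro _ ⟨⟨i, hi⟩, hi2, rfl⟩
        have : i = 0 ∨ i = 1 := by simp at hi2; omega
        refine iff_of_true (hbase _ _ (by simp) (by simp at hi2 ⊢; omega) ?_) ?_
        · simp at hi2 ⊢; omega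
        · rcases this with rfl | rfl <;> simp
      · obtain ⟨s, hs, hsj⟩ := hstep ⟨k, by omega⟩ hk
        obtain ⟨p, q, hpq, rfl⟩ := Finset.card_eq_two.1 hs.card_eq
        have mem : ∀ y ∈ ({p, q} : Finset V), ∃ i : Fin n, i.val < k ∧ v i = y := by
          intro y hy
          rw [← v.apply_symm_apply y, hsj] at hy
          exact ⟨v.symm y, hy.1, v.apply_symm_apply y⟩
        refine .attach (p := p) (q := q) (ih (by omega)) hx (mem p (by simp)) (mem q (by simp))
          (hs.isClique (by simp) (by simp) hpq) ?_
        rintro _ ⟨i, hi, rfl⟩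
        have := hsj i
        simp only [Finset.mem_insert, Finset.mem_singleton] at this
        rw [this, G.adj_comm]
        exact ⟨fun h => ⟨hi, h⟩, fun h => h.2⟩
  convert key n (by omega) le_rfl using 1
  ext x
  simp only [Set.mem_univ, Set.mem_ofPred_eq, true_iff]
  exact ⟨v.symm x, Fin.is_lt _, v.apply_symm_apply x⟩

/-! ### Strips and their positions -/

/-- `v 0, …, v (m - 1)` is a `2`-path whose vertices carry the pairs of distances to the edge
formed by `v 1` and `v 0`. -/
structure IsStrip {V : Type*} (G : SimpleGraph V) (f g : V → ℕ) (m : ℕ) (v : ℕ → V) : Prop where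
  two_le : 2 ≤ m
  -- Index 0 is exceptional: the formulas below would give (0,0) instead of (1,0).
  left_zero : f (v 0) = 1
  right_zero : g (v 0) = 0
  left_eq : ∀ i, 1 ≤ i → i < m → f (v i) = i / 2
  right_eq : ∀ i, 1 ≤ i → i < m → g (v i) = (i + 1) / 2
  adj_iff : ∀ i < m, ∀ j < m, G.Adj (v i) (v j) ↔ i ≠ j ∧ i ≤ j + 2 ∧ j ≤ i + 2

namespace IsStrip

variable {V : Type*} {G : SimpleGraph V} {f g : V → ℕ} {m : ℕ} {v : ℕ → V}

/-- From index 1 on, f + g equals the index and f ≤ g, while f > g at index 0. -/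
theorem inj (h : IsStrip G f g m v) {i j : ℕ} (hi : i < m) (hj : j < m) (hij : v i = v j) :
    i = j := by
  have h0 := h.left_zero
  have h1 := h.right_zero
  have hf := congrArg f hij
  have hg := congrArg g hij
  rcases Nat.eq_zero_or_pos i with rfl | hi0 <;> rcases Nat.eq_zero_or_pos j with rfl | hj0
  · rfl
  · have := h.left_eq j hj0 hj
    have := h.right_eq j hj0 hj
    omega
  · have := h.left_eq i hi0 hi
    have := h.right_eq i hi0 hi
    omega
  · have := h.left_eq j hj0 hj
    have := h.right_eq j hj0 hj
    have := h.left_eq i hi0 hi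
    have := h.right_eq i hi0 hi
    omega

/-- The position (2,1) of the extra vertex of a cane has f > g, and the only such position on a
strip is (1,0). -/
theorem ne_of_eq (h : IsStrip G f g m v) {w : V} (hf : f w = 2) (hg : g w = 1) :
    ∀ i < m, v i ≠ w := by
  rintro i hi rfl
  have h0 := h.left_zero
  rcases Nat.eq_zero_or_pos i with rfl | hi0
  · omega
  · have := h.left_eq i hi0 hi
    have := h.right_eq i hi0 hi
    omega

theorem extend (h : IsStrip G f g m v) {x : V} (hf : f x = m / 2) (hg : g x = (m + 1) / 2)
    (hadj : ∀ i < m, G.Adj x (v i) ↔ m ≤ i + 2) :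
    IsStrip G f g (m + 1) (Function.update v m x) := by
  have hm := h.two_le
  have hv : ∀ i < m, Function.update v m x i = v i := fun i hi =>
    Function.update_of_ne (by omega) _ _
  have hx : Function.update v m x m = x := Function.update_self _ _ _
  refine ⟨by omega, ?_, ?_, ?_, ?_, ?_⟩
  · rw [hv 0 (by omega)]; exact h.left_zero
  · rw [hv 0 (by omega)]; exact h.right_zero
  · intro i h1 hi
    rcases Nat.lt_succ_iff_lt_or_eq.1 hi with hi | rfl
    · rw [hv i hi]; exact h.left_eq i h1 hi
    · rw [hx, hf]
  · intro i h1 hi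
    rcases Nat.lt_succ_iff_lt_or_eq.1 hi with hi | rfl
    · rw [hv i hi]; exact h.right_eq i h1 hi
    · rw [hx, hg]
  · intro i hi j hj
    rcases Nat.lt_succ_iff_lt_or_eq.1 hi with hi | rfl <;>
      rcases Nat.lt_succ_iff_lt_or_eq.1 hj with hj | rfl
    · rw [hv i hi, hv j hj]; exact h.adj_iff i hi j hj
    · rw [hv i hi, hx, G.adj_comm, hadj i hi]; omega
    · rw [hv j hj, hx, hadj j hj]; omega
    · simp

/-- The first three vertices of a strip form a strip when the two first ones are exchanged. -/
theorem swap (h : IsStrip G f g m v) (hm : 3 ≤ m) :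
    IsStrip G g f 3 (v ∘ Equiv.swap 0 1) := by
  have e0 : (v ∘ Equiv.swap 0 1) 0 = v 1 := by simp
  have e1 : (v ∘ Equiv.swap 0 1) 1 = v 0 := by simp
  have e2 : (v ∘ Equiv.swap 0 1) 2 = v 2 := by
    simp [Equiv.swap_apply_of_ne_of_ne]
  have f1 := h.left_eq 1 (by omega) (by omega)
  have g1 := h.right_eq 1 (by omega) (by omega)
  have f2 := h.left_eq 2 (by omega) (by omega)
  have g2 := h.right_eq 2 (by omega) (by omega)
  have f0 := h.left_zero
  have g0 := h.right_zero
  refine ⟨by omega, by rw [e0, g1], by rw [e0, f1], ?_, ?_, ?_⟩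
  · intro i h1 hi
    interval_cases i
    · rw [e1, g0]
    · rw [e2, g2]
  · intro i h1 hi
    interval_cases i
    · rw [e1, f0]
    · rw [e2, f2]
  · intro i hi j hj
    interval_cases i <;> interval_cases j <;> simp only [e0, e1, e2] <;>
      rw [h.adj_iff _ (by omega) _ (by omega)] <;> omega

end IsStrip

/-- `S` is the vertex set of a strip, or of a strip and one further vertex attached to the
first and the third vertex of the strip. -/
def IsStripOrCane {V : Type*} (G : SimpleGraph V) (f g : V → ℕ) (S : Set V) : Prop :=
  ∃ (m : ℕ) (v : ℕ → V), IsStrip G f g m v ∧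
    ((∀ x, x ∈ S ↔ ∃ i < m, v i = x) ∨
      ∃ w, 4 ≤ m ∧ f w = 2 ∧ g w = 1 ∧ (∀ i < m, G.Adj w (v i) ↔ i = 0 ∨ i = 2) ∧
        ∀ x, x ∈ S ↔ x = w ∨ ∃ i < m, v i = x)

/-! ### Attaching a vertex to a strip or a cane -/

section Attach

variable {V : Type*} {G : SimpleGraph V} {f g : V → ℕ} {m : ℕ} {v : ℕ → V} {S : Set V}

theorem exists_update_iff (v : ℕ → V) (m : ℕ) (x y : V) :
    (∃ i < m + 1, Function.update v m x i = y) ↔ y = x ∨ ∃ i < m, v i = y := by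
  constructor
  · rintro ⟨i, hi, rfl⟩
    rcases Nat.lt_succ_iff_lt_or_eq.1 hi with hi | rfl
    · exact Or.inr ⟨i, hi, by rw [Function.update_of_ne hi.ne]⟩
    · simp
  · rintro (rfl | ⟨i, hi, rfl⟩)
    · exact ⟨m, by omega, by simp⟩
    · exact ⟨i, by omega, by rw [Function.update_of_ne hi.ne]⟩

theorem exists_swap_iff (v : ℕ → V) (y : V) :
    (∃ i < 3, (v ∘ Equiv.swap 0 1) i = y) ↔ ∃ i < 3, v i = y := by
  have h : ∀ i < 3, Equiv.swap 0 1 i < 3 := by decide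
  constructor
  · rintro ⟨i, hi, rfl⟩
    exact ⟨_, h i hi, rfl⟩
  · rintro ⟨i, hi, rfl⟩
    exact ⟨_, h i hi, by simp⟩

/-- A vertex attached to an edge of a strip either continues the strip or is attached to its first
and third vertices. -/
theorem IsStrip.attach_cases (hinj : ∀ x y, f x = f y → g x = g y → x = y)
    (h : IsStrip G f g m v) {x : V} (hx : ∀ i < m, v i ≠ x) {i j : ℕ} (hij : i < j) (hj : j < m)
    (hadj : G.Adj (v i) (v j)) (hf : f x = min (f (v i)) (f (v j)) + 1)
    (hg : g x = min (g (v i)) (g (v j)) + 1) :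
    (i + 2 = m ∧ j + 1 = m ∧ f x = m / 2 ∧ g x = (m + 1) / 2) ∨
      (i = 0 ∧ j = 2 ∧ f x = 2 ∧ g x = 1) := by
  have hj2 := ((h.adj_iff i (by omega) j hj).1 hadj).2.2
  have hfj := h.left_eq j (by omega) hj
  have hgj := h.right_eq j (by omega) hj
  -- Every edge `v i`, `v j` with i < j except v 0 v 2 yields the position of index i + 2, which
  -- must not be occupied.
  have key : ¬ (i + 2 < m ∧ f x = (i + 2) / 2 ∧ g x = (i + 3) / 2) := fun ⟨h1, h2, h3⟩ =>
    hx (i + 2) h1 (hinj _ _ (by rw [h2, h.left_eq _ (by omega) h1])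
      (by rw [h3, h.right_eq _ (by omega) h1]))
  rcases Nat.eq_zero_or_pos i with rfl | hi
  · have hfi := h.left_zero
    have hgi := h.right_zero
    obtain rfl | rfl : j = 1 ∨ j = 2 := by omega
    · left; omega
    · right; omega
  · have hfi := h.left_eq i hi (by omega)
    have hgi := h.right_eq i hi (by omega)
    left; omega

/-- Attaching a vertex to an edge of the strip. -/
theorem IsStripOrCane.attach_strip (hinj : ∀ x y, f x = f y → g x = g y → x = y)
    (hv : IsStrip G f g m v)
    (hS : (∀ x, x ∈ S ↔ ∃ i < m, v i = x) ∨
      ∃ w, 4 ≤ m ∧ f w = 2 ∧ g w = 1 ∧ (∀ i < m, G.Adj w (v i) ↔ i = 0 ∨ i = 2) ∧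
        ∀ x, x ∈ S ↔ x = w ∨ ∃ i < m, v i = x)
    {x : V} (hx : x ∉ S) {i j : ℕ} (hij : i < j) (hj : j < m) (hadjv : G.Adj (v i) (v j))
    (hadj : ∀ y ∈ S, G.Adj x y ↔ y = v i ∨ y = v j)
    (hf : f x = min (f (v i)) (f (v j)) + 1) (hg : g x = min (g (v i)) (g (v j)) + 1) :
    IsStripOrCane G f g (insert x S) ∨ IsStripOrCane G g f (insert x S) := by
  have hm := hv.two_le
  have hvS : ∀ i < m, v i ∈ S := fun i hi => by
    rcases hS with hS | ⟨w, -, -, -, -, hS⟩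
    · exact (hS _).2 ⟨i, hi, rfl⟩
    · exact (hS _).2 (Or.inr ⟨i, hi, rfl⟩)
  have hxv : ∀ i < m, v i ≠ x := fun i hi e => hx (e ▸ hvS i hi)
  have hadjx : ∀ k < m, G.Adj x (v k) ↔ k = i ∨ k = j := fun k hk => by
    have hki : v k = v i ↔ k = i := ⟨hv.inj hk (by omega), fun e => e ▸ rfl⟩
    have hkj : v k = v j ↔ k = j := ⟨hv.inj hk (by omega), fun e => e ▸ rfl⟩
    rw [hadj _ (hvS k hk), hki, hkj]
  rcases hv.attach_cases hinj hxv hij hj hadjv hf hg with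
    ⟨hi, hj', hfx, hgx⟩ | ⟨rfl, rfl, hfx, hgx⟩
  · left
    refine ⟨m + 1, Function.update v m x,
      hv.extend hfx hgx fun k hk => (hadjx k hk).trans (by omega), ?_⟩
    rcases hS with hS | ⟨w, hm4, hfw, hgw, hw, hS⟩
    · left
      intro y
      rw [exists_update_iff, Set.mem_insert_iff, hS]
    · right
      refine ⟨w, by omega, hfw, hgw, fun k hk => ?_, fun y => ?_⟩
      · rcases Nat.lt_succ_iff_lt_or_eq.1 hk with hk | rfl
        · rw [Function.update_of_ne hk.ne]; exact hw k hk
        · have hwv := hv.ne_of_eq hfw hgw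
          rw [Function.update_self, G.adj_comm, hadj w ((hS w).2 (Or.inl rfl))]
          refine iff_of_false ?_ (by omega)
          rintro (h | h)
          · exact hwv i (by omega) h.symm
          · exact hwv j (by omega) h.symm
      · rw [exists_update_iff, Set.mem_insert_iff, hS]
        exact or_left_comm
  · rcases hS with hS | ⟨w, hm4, hfw, hgw, hw, hS⟩
    -- On three vertices, `x` extends the strip v 1, v 0, v 2; on more, it makes a cane.
    · rcases (show m = 3 ∨ 4 ≤ m by omega) with rfl | hm4
      · right
        refine ⟨4, Function.update (v ∘ Equiv.swap 0 1) 3 x,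
          (hv.swap le_rfl).extend (by omega) (by omega) ?_, Or.inl fun y => ?_⟩
        · intro k hk
          interval_cases k
          · simpa using mt (hadjx 1 (by omega)).1 (by omega)
          · simpa using (hadjx 0 (by omega)).2 (by omega)
          · simpa [Equiv.swap_apply_of_ne_of_ne] using (hadjx 2 (by omega)).2 (by omega)
        · rw [exists_update_iff, exists_swap_iff, Set.mem_insert_iff, hS]
      · left
        refine ⟨m, v, hv, Or.inr ⟨x, hm4, hfx, hgx, hadjx, fun y => ?_⟩⟩
        rw [Set.mem_insert_iff, hS]
    · exact absurd ((hS x).2 (Or.inl (hinj _ _ (by omega) (by omega)))) hx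

/-- Attaching a vertex to an edge at the vertex outside the strip. -/
theorem IsStripOrCane.attach_pendant (hinj : ∀ x y, f x = f y → g x = g y → x = y)
    (hv : IsStrip G f g m v) {w : V} (hm4 : 4 ≤ m) (hfw : f w = 2) (hgw : g w = 1)
    (hw : ∀ i < m, G.Adj w (v i) ↔ i = 0 ∨ i = 2)
    (hS : ∀ x, x ∈ S ↔ x = w ∨ ∃ i < m, v i = x)
    {x : V} (hx : x ∉ S) {j : ℕ} (hj : j < m) (hwj : G.Adj w (v j))
    (hadj : ∀ y ∈ S, G.Adj x y ↔ y = w ∨ y = v j)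
    (hf : f x = min (f w) (f (v j)) + 1) (hg : g x = min (g w) (g (v j)) + 1) :
    IsStripOrCane G g f (insert x S) := by
  have hwS : w ∈ S := (hS w).2 (Or.inl rfl)
  have hvS : ∀ i < m, v i ∈ S := fun i hi => (hS _).2 (Or.inr ⟨i, hi, rfl⟩)
  have hxv : ∀ i < m, v i ≠ x := fun i hi e => hx (e ▸ hvS i hi)
  have hwv := hv.ne_of_eq hfw hgw
  have f0 := hv.left_zero
  have g0 := hv.right_zero
  have f2 := hv.left_eq 2 (by omega) (by omega)
  have g2 := hv.right_eq 2 (by omega) (by omega)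
  have f3 := hv.left_eq 3 (by omega) (by omega)
  have g3 := hv.right_eq 3 (by omega) (by omega)
  rcases (hw j hj).1 hwj with rfl | rfl
  -- The edge w v 0 yields (2,1), the position of `w` itself.
  · exact absurd ((hS x).2 (Or.inl (hinj _ _ (by omega) (by omega)))) hx
  -- The edge w v 2 yields (2,2), the position of v 4, hence m = 4.
  rcases hm4.eq_or_lt with rfl | hm5
  swap
  · have f4 := hv.left_eq 4 (by omega) (by omega)
    have g4 := hv.right_eq 4 (by omega) (by omega)
    exact absurd (hinj _ _ (by omega) (by omega)) (hxv 4 (by omega))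
  have hadjx : ∀ k < 4, G.Adj x (v k) ↔ k = 2 := fun k hk => by
    have hk2 : v k = v 2 ↔ k = 2 := ⟨hv.inj hk (by omega), fun e => e ▸ rfl⟩
    rw [hadj _ (hvS k hk), hk2, or_iff_right (hwv k hk)]
  have hxw : G.Adj x w := (hadj w hwS).2 (Or.inl rfl)
  have s2 : (v ∘ Equiv.swap 0 1) 2 = v 2 := by simp [Equiv.swap_apply_of_ne_of_ne]
  -- The new strip is v 1, v 0, v 2, w, x; the old end v 3, adjacent to v 1 and v 2, becomes the
  -- extra vertex.
  have hstrip : IsStrip G g f 5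
      (Function.update (Function.update (v ∘ Equiv.swap 0 1) 3 w) 4 x) := by
    refine ((hv.swap (by omega)).extend (by omega) (by omega) ?_).extend
      (by omega) (by omega) ?_
    · intro k hk
      interval_cases k
      · simpa using mt (hw 1 (by omega)).1 (by omega)
      · simpa using (hw 0 (by omega)).2 (by omega)
      · rw [s2]
        simpa using (hw 2 (by omega)).2 (by omega)
    · intro k hk
      interval_cases k
      · simpa using mt (hadjx 1 (by omega)).1 (by omega)
      · simpa using mt (hadjx 0 (by omega)).1 (by omega)
      · rw [Function.update_of_ne (by omega), s2]
        simpa using (hadjx 2 (by omega)).2 (by omega)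
      · simpa using hxw
  refine ⟨5, _, hstrip, Or.inr ⟨v 3, by omega, by omega, by omega, ?_, fun y => ?_⟩⟩
  · intro k hk
    interval_cases k
    · simpa using (hv.adj_iff 3 (by omega) 1 (by omega)).2 (by omega)
    · simpa using mt (hv.adj_iff 3 (by omega) 0 (by omega)).1 (by omega)
    · rw [Function.update_of_ne (by omega), Function.update_of_ne (by omega), s2]
      simpa using (hv.adj_iff 3 (by omega) 2 (by omega)).2 (by omega)
    · simpa [G.adj_comm] using mt (hw 3 (by omega)).1 (by omega)
    · simpa [G.adj_comm] using mt (hadjx 3 (by omega)).1 (by omega)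
  · have h3 := exists_update_iff v 3 (v 3) y
    rw [Function.update_eq_self] at h3
    rw [exists_update_iff, exists_update_iff, exists_swap_iff, Set.mem_insert_iff, hS, h3,
      or_left_comm (a := y = v 3), or_left_comm (a := y = v 3)]

theorem IsStripOrCane.attach (hinj : ∀ x y, f x = f y → g x = g y → x = y)
    (h : IsStripOrCane G f g S) {x p q : V} (hx : x ∉ S) (hp : p ∈ S) (hq : q ∈ S)
    (hpq : G.Adj p q) (hadj : ∀ y ∈ S, G.Adj x y ↔ y = p ∨ y = q)
    (hf : f x = min (f p) (f q) + 1) (hg : g x = min (g p) (g q) + 1) :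
    IsStripOrCane G f g (insert x S) ∨ IsStripOrCane G g f (insert x S) := by
  obtain ⟨m, v, hv, hS⟩ := h
  have hadj' : ∀ y ∈ S, G.Adj x y ↔ y = q ∨ y = p := fun y hy => (hadj y hy).trans or_comm
  have hf' : f x = min (f q) (f p) + 1 := by rw [hf, min_comm]
  have hg' : g x = min (g q) (g p) + 1 := by rw [hg, min_comm]
  have strip : (∃ i < m, v i = p) → (∃ j < m, v j = q) →
      IsStripOrCane G f g (insert x S) ∨ IsStripOrCane G g f (insert x S) := by
    rintro ⟨i, hi, rfl⟩ ⟨j, hj, rfl⟩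
    rcases lt_trichotomy i j with hij | rfl | hij
    · exact attach_strip hinj hv hS hx hij hj hpq hadj hf hg
    · exact absurd rfl hpq.ne
    · exact attach_strip hinj hv hS hx hij hi hpq.symm hadj' hf' hg'
  rcases hS with hS | ⟨w, hm4, hfw, hgw, hw, hS⟩
  · exact strip ((hS p).1 hp) ((hS q).1 hq)
  rcases (hS p).1 hp with rfl | hpi <;> rcases (hS q).1 hq with rfl | hqj
  · exact absurd rfl hpq.ne
  · obtain ⟨j, hj, rfl⟩ := hqj
    exact Or.inr (attach_pendant hinj hv hm4 hfw hgw hw hS hx hj hpq hadj hf hg)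
  · obtain ⟨i, hi, rfl⟩ := hpi
    exact Or.inr (attach_pendant hinj hv hm4 hfw hgw hw hS hx hi hpq.symm hadj' hf' hg')
  · exact strip hpi hqj

/-- If every vertex of `insert x S` other than `a` has a neighbour nearer to `a` there, then the
same is true in `S`, and the value at `x` is determined by its two neighbours. -/
theorem descent_of_insert {a x p q : V} (hlip : ∀ u w, G.Adj u w → f u ≤ f w + 1)
    (ha : a ∈ S) (hx : x ∉ S) (hp : p ∈ S) (hq : q ∈ S) (hpq : G.Adj p q)
    (hadj : ∀ y ∈ S, G.Adj x y ↔ y = p ∨ y = q)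
    (h : ∀ y ∈ insert x S, y ≠ a → ∃ z ∈ insert x S, G.Adj y z ∧ f y = f z + 1) :
    (∀ y ∈ S, y ≠ a → ∃ z ∈ S, G.Adj y z ∧ f y = f z + 1) ∧ f x = min (f p) (f q) + 1 := by
  have h1 := hlip p q hpq
  have h2 := hlip q p hpq.symm
  have h3 := hlip x p ((hadj p hp).2 (Or.inl rfl))
  have h4 := hlip x q ((hadj q hq).2 (Or.inr rfl))
  have hfx : f x = min (f p) (f q) + 1 := by
    obtain ⟨z, hz, hxz, hfz⟩ := h x (Set.mem_insert _ _) (fun e => hx (e ▸ ha))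
    have hzS : z ∈ S := hz.resolve_left hxz.ne'
    rcases (hadj z hzS).1 hxz with rfl | rfl <;> omega
  refine ⟨fun y hy hya => ?_, hfx⟩
  -- The nearer neighbour cannot be `x`: then `y` is `p` or `q` with f y = min(f p, f q) + 2, but f
  -- differs by at most 1 along `pq`.
  obtain ⟨z, hz | hz, hyz, hfz⟩ := h y (Set.mem_insert_of_mem _ hy) hya
  · subst hz
    rcases (hadj y hy).1 hyz.symm with rfl | rfl <;> omega
  · exact ⟨z, hz, hyz, hfz⟩

/-- Stating the distance properties as Lipschitz and descent conditions on fixed f and g lets the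
induction shrink `S` without comparing distances in subgraphs. -/
theorem TwoTreeOn.isStripOrCane {a b : V} (h : TwoTreeOn G a b S)
    (hinj : ∀ x y, f x = f y → g x = g y → x = y)
    (hflip : ∀ u w, G.Adj u w → f u ≤ f w + 1) (hglip : ∀ u w, G.Adj u w → g u ≤ g w + 1)
    (hfa : f a = 0) (hfb : f b = 1) (hga : g a = 1) (hgb : g b = 0)
    (hf : ∀ y ∈ S, y ≠ a → ∃ z ∈ S, G.Adj y z ∧ f y = f z + 1)
    (hg : ∀ y ∈ S, y ≠ b → ∃ z ∈ S, G.Adj y z ∧ g y = g z + 1) :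
    IsStripOrCane G f g S ∨ IsStripOrCane G g f S := by
  induction h with
  | edge h =>
    left
    refine ⟨2, fun i => if i = 0 then b else a, ⟨le_rfl, by simpa, by simpa, ?_, ?_, ?_⟩,
      Or.inl fun x => ?_⟩
    · intro i h1 h2
      obtain rfl : i = 1 := by omega
      simpa
    · intro i h1 h2
      obtain rfl : i = 1 := by omega
      simpa
    · intro i hi j hj
      interval_cases i <;> interval_cases j <;> simp [h, h.symm]
    · constructor
      · rintro (rfl | rfl)
        · exact ⟨1, by omega, by simp⟩
        · exact ⟨0, by omega, by simp⟩
      · rintro ⟨i, hi, rfl⟩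
        interval_cases i <;> simp
  | attach h hx hp hq hpq hadj ih =>
    obtain ⟨hf', hfx⟩ := descent_of_insert hflip h.left_mem hx hp hq hpq hadj hf
    obtain ⟨hg', hgx⟩ := descent_of_insert hglip h.right_mem hx hp hq hpq hadj hg
    rcases ih hf' hg' with ih | ih
    · exact ih.attach hinj hx hp hq hpq hadj hfx hgx
    · exact (ih.attach (fun u w h1 h2 => hinj u w h2 h1) hx hp hq hpq hadj hgx hfx).symm

theorem IsStripOrCane.isKPath_or_isCane (h : IsStripOrCane G f g Set.univ)
    (hcard : 3 ≤ Nat.card V) : IsKPath 2 G ∨ IsCane G := by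
  obtain ⟨m, v, hv, hS | ⟨w, hm, hfw, hgw, hw, hS⟩⟩ := h
  · left
    have hbij : Function.Bijective fun i : Fin m => v i :=
      ⟨fun i j hij => Fin.ext (hv.inj i.2 j.2 hij), fun x =>
        let ⟨i, hi, e⟩ := (hS x).1 trivial
        ⟨⟨i, hi⟩, e⟩⟩
    have hm : 3 ≤ m := by
      rwa [← Nat.card_congr (Equiv.ofBijective _ hbij), Nat.card_fin] at hcard
    let e : kPathGraph 2 m ≃g G :=
      { toEquiv := Equiv.ofBijective _ hbij
        map_rel_iff' := fun {i j} =>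
          (hv.adj_iff i i.2 j j.2).trans (and_congr_left' (not_congr Fin.ext_iff.symm)) }
    exact ⟨m, hm, ⟨e.symm⟩⟩
  · right
    have hwv := hv.ne_of_eq hfw hgw
    have hbij : Function.Bijective fun o : Option (Fin m) => o.elim w fun i => v i := by
      constructor
      · rintro (_ | i) (_ | j) hij
        · rfl
        · exact absurd hij.symm (hwv j j.2)
        · exact absurd hij (hwv i i.2)
        · exact congrArg some (Fin.ext (hv.inj i.2 j.2 hij))
      · intro x
        rcases (hS x).1 trivial with rfl | ⟨i, hi, rfl⟩
        · exact ⟨none, rfl⟩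
        · exact ⟨some ⟨i, hi⟩, rfl⟩
    let e : caneGraph m ≃g G :=
      { toEquiv := Equiv.ofBijective _ hbij
        map_rel_iff' := by
          rintro (_ | i) (_ | j)
          · exact iff_of_false (G.loopless.irrefl w) id
          · exact hw j j.2
          · exact (G.adj_comm _ _).trans (hw i i.2)
          · exact (hv.adj_iff i i.2 j j.2).trans
              (and_congr_left' (not_congr Fin.ext_iff.symm)) }
    exact ⟨m, by omega, ⟨e.symm⟩⟩

end Attach

/-! ### Distances to the basis and the conclusion -/

theorem SimpleGraph.Reachable.exists_adj_dist_eq_succ {V : Type*} {G : SimpleGraph V} {x a : V}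
    (h : G.Reachable x a) (hne : x ≠ a) : ∃ z, G.Adj x z ∧ G.dist x a = G.dist z a + 1 := by
  obtain ⟨p, hp⟩ := h.exists_walk_length_eq_dist
  cases p with
  | nil => exact absurd rfl hne
  | @cons _ z _ hxz p =>
    refine ⟨z, hxz, ?_⟩
    have h1 := SimpleGraph.dist_le p
    obtain ⟨p', hp'⟩ := p.reachable.exists_walk_length_eq_dist
    have h2 := SimpleGraph.dist_le (SimpleGraph.Walk.cons hxz p')
    simp only [SimpleGraph.Walk.length_cons] at hp h2
    omega

theorem mainTheorem2 {V : Type*} [Finite V] [DecidableEq V] (G : SimpleGraph V)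
    (hG : IsKTree 2 G) (hdim : metricDim G = 2) (a b : V) (hab : G.Adj a b)
    (hbasis : IsMetricBasis G {a, b}) :
    IsKPath 2 G ∨ IsCane G := by
  obtain ⟨hcard, c, d, hT⟩ := hG.exists_twoTreeOn
  have h := hT.reroot a trivial b trivial hab
  have lip : ∀ r, G.Reachable r a → ∀ u w, G.Adj u w → G.dist u r ≤ G.dist w r + 1 := by
    intro r hr u w huw
    obtain ⟨p, hp⟩ := ((h.reachable w trivial).trans hr.symm).exists_walk_length_eq_dist
    have := SimpleGraph.dist_le (SimpleGraph.Walk.cons huw p)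
    rwa [SimpleGraph.Walk.length_cons, hp] at this
  have key := h.isStripOrCane (f := fun x => G.dist x a) (g := fun x => G.dist x b)
    (fun x y h1 h2 => hbasis.1 x y (by simp [h1, h2]))
    (lip a (h.reachable a trivial)) (lip b (h.reachable b trivial))
    (by simp) (SimpleGraph.dist_eq_one_iff_adj.2 hab.symm)
    (SimpleGraph.dist_eq_one_iff_adj.2 hab) (by simp)
    (fun y _ hy => by
      obtain ⟨z, h1, h2⟩ := (h.reachable y trivial).exists_adj_dist_eq_succ hy
      exact ⟨z, trivial, h1, h2⟩)
    (fun y _ hy => by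
      obtain ⟨z, h1, h2⟩ := (h.symm.reachable y trivial).exists_adj_dist_eq_succ hy
      exact ⟨z, trivial, h1, h2⟩)
  rcases key with key | key <;> exact key.isKPath_or_isCane hcard
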